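/- Let $A$, $B$, $J$ be finite-dimensional Hilbert spaces, let $\mathcal N:\mathcal L(A\otimes J)\to\mathcal L(B)$ be a completely positive trace-preserving (cptp) map (a quantum arbitrarily varying channel, with jammer system $J$), and let $\ell$ be a block length. A classical code with $M$ messages is a family $\mathcal C=\{(\rho_m,D_m)\}_{m=1}^M$ of states $\rho_m$ on $A^{\otimes\ell}$ and a POVM $(D_m)_m$ on $B^{\otimes\ell}$ (that is, $D_m\ge 0$ and $\sum_m D_m=\mathbf 1$); its error probability against a jammer state $\sigma$ on $J^{\otimes\ell}$ is $$P_{\mathrm{err}}(\mathcal C,\sigma)=\frac1M\sum_{m=1}^M\operatorname{tr}\,\mathcal N^{\otimes\ell}(\rho_m\otimes\sigma)(\mathbf 1-D_m).$$ A quantum code of dimension $L$ is a pair $\mathcal Q=(\mathcal E,\mathcal D)$ of cptp maps $\mathcal E:\mathcal L(\mathbb C^L)\to\mathcal L(A^{\otimes\ell})$, $\mathcal D:\mathcal L(B^{\otimes\ell})\to\mathcal L(\mathbb C^L)$; its infidelity against $\sigma$ is $$\widehat F(\mathcal Q,\sigma)=1-\operatorname{tr}\bigl((\mathrm{id}\otimes\mathcal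 D\circ\mathcal N^{\otimes\ell}_\sigma\circ\mathcal E)\Phi_L\bigr)\Phi_L,\qquad \Phi_L=\frac1L\sum_{i,j}|ii\rangle\langle jj|,\quad \mathcal N^{\otimes\ell}_\sigma(\rho)=\mathcal N^{\otimes\ell}(\rho\otimes\sigma).$$ A random classical [quantum] code is a family $(\mathcal C_\lambda)_{\lambda\in\Lambda}$ [$(\mathcal Q_\lambda)_{\lambda\in\Lambda}$] of such codes, with common $M$ [$L$], together with a probability distribution of $\lambda$ on $\Lambda$ for which $\lambda\mapsto P_{\mathrm{err}}(\mathcal C_\lambda,\sigma)$ [$\lambda\mapsto\widehat F(\mathcal Q_\lambda,\sigma)$] is measurable for every $\sigma$. It has error probability [infidelity] $\epsilon$ if $\sup_\sigma\mathbb E_\lambda P_{\mathrm{err}}(\mathcal C_\lambda,\sigma)\le\epsilon$ [$\sup_\sigma\mathbb E_\lambda\widehat F(\mathcal Q_\lambda,\sigma)\le\epsilon$], the supremum being over all states $\sigma$ on $J^{\otimes\ell}$. **Proposition.** Let $\delta>0$. 1. If $(\mathcal C_\lambda)_{\lambda\in\Lambda}$ is a random classical code of block length $\ell$ for $\mathcal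 N$ with error probability $\epsilon$, then there are $n\ge1$ with $n\le 1+\frac{1}{2\delta^2}(\ln|J|)\,\ell$ and $\lambda_1,\dots,\lambda_n\in\Lambda$ such that the random code $(\mathcal C_{\lambda_\nu})$ with $\nu$ uniformly distributed on $\{1,\dots,n\}$ has error probability $\le\epsilon+\delta$. 2. If $(\mathcal Q_\lambda)_{\lambda\in\Lambda}$ is a random quantum code of block length $\ell$ for $\mathcal N$ with infidelity $\epsilon$, then there are $n\ge1$ with $n\le 1+\frac{1}{2\delta^2}(\ln|J|)\,\ell$ and $\lambda_1,\dots,\lambda_n\in\Lambda$ such that the random code $(\mathcal Q_{\lambda_\nu})$ with $\nu$ uniformly distributed on $\{1,\dots,n\}$ has infidelity $\le\epsilon+\delta$. In both cases the number $\log_2 n$ of shared random bits is at most $b(\ell)$ for a function $b$ that depends only on $J$ and $\delta$ and satisfies $b(\ell)=O(\log\ell)$ as $\ell\to\infty$. -/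

import Mathlib

open scoped Kronecker ComplexOrder

noncomputable section

namespace QAVC

/-- The states (density matrices) of the finite-dimensional Hilbert space with orthonormal
basis `P`. -/
structure State (P : Type*) [Fintype P] where
  mat : Matrix P P ℂ
  posSemidef : mat.PosSemidef
  trace_eq_one : mat.trace = 1

/-- `id_R ⊗ T`, acting blockwise. -/
def idTensor (R : Type*) {P Q : Type*} (T : Matrix P P ℂ →ₗ[ℂ] Matrix Q Q ℂ) :
    Matrix (R × P) (R × P) ℂ →ₗ[ℂ] Matrix (R × Q) (R × Q) ℂ where
  toFun X := Matrix.of fun x y => T (X.submatrix (Prod.mk x.1) (Prod.mk y.1)) x.2 y.2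
  map_add' X Y := by
    ext x y
    simp [Matrix.submatrix_add]
  map_smul' c X := by
    ext x y
    simp [Matrix.submatrix_smul]

/-- Completely positive trace-preserving maps `L(P) → L(Q)`. -/
structure Channel (P Q : Type*) [Fintype P] [Fintype Q] where
  map : Matrix P P ℂ →ₗ[ℂ] Matrix Q Q ℂ
  completelyPositive : ∀ (k : ℕ) (X : Matrix (Fin k × P) (Fin k × P) ℂ),
    X.PosSemidef → (idTensor (Fin k) map X).PosSemidef
  tracePreserving : ∀ X : Matrix P P ℂ, (map X).trace = X.trace

section

variable {A B J : Type*} [Fintype A] [DecidableEq A] [Fintype B] [DecidableEq B]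
  [Fintype J] [DecidableEq J]

/-- The tensor power `N^{⊗ℓ} : L(A^ℓ ⊗ J^ℓ) → L(B^ℓ)`, where `A^ℓ` has the product basis
`Fin ℓ → A`, and similarly for `J` and `B`. It is the linear map that sends the matrix unit
`|a,j⟩⟨a',j'|` to the tensor product over `i` of the matrices `N(|a_i,j_i⟩⟨a'_i,j'_i|)`. -/
def tensorPower (N : Matrix (A × J) (A × J) ℂ →ₗ[ℂ] Matrix B B ℂ) (ℓ : ℕ) :
    Matrix ((Fin ℓ → A) × (Fin ℓ → J)) ((Fin ℓ → A) × (Fin ℓ → J)) ℂ →ₗ[ℂ]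
      Matrix (Fin ℓ → B) (Fin ℓ → B) ℂ where
  toFun X := Matrix.of fun b b' => ∑ x, ∑ y, X x y *
    ∏ i, N (Matrix.single (x.1 i, x.2 i) (y.1 i, y.2 i) 1) (b i) (b' i)
  map_add' X Y := by
    ext b b'
    simp [add_mul, Finset.sum_add_distrib]
  map_smul' c X := by
    ext b b'
    simp [Finset.mul_sum, mul_assoc]

/-- The map `ρ ↦ T(ρ ⊗ σ)` obtained by fixing the second input of `T` to `σ`. -/
def fixSecond {P R Q : Type*} (T : Matrix (P × R) (P × R) ℂ →ₗ[ℂ] Matrix Q Q ℂ)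
    (σ : Matrix R R ℂ) : Matrix P P ℂ →ₗ[ℂ] Matrix Q Q ℂ where
  toFun ρ := T (ρ ⊗ₖ σ)
  map_add' X Y := by rw [Matrix.add_kronecker, map_add]
  map_smul' c X := by rw [Matrix.smul_kronecker, map_smul, RingHom.id_apply]

/-- Deterministic classical codes with `M` messages for block length `ℓ`: input states `ρ_m`
on `A^ℓ` and a POVM `(D_m)` on `B^ℓ`. -/
structure ClassicalCode (A B : Type*) [Fintype A] [Fintype B] [DecidableEq B] (ℓ M : ℕ) where
  encoder : Fin M → State (Fin ℓ → A)
  decoder : Fin M → Matrix (Fin ℓ → B) (Fin ℓ → B) ℂ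
  decoder_posSemidef : ∀ m, (decoder m).PosSemidef
  decoder_sum : ∑ m, decoder m = 1

/-- The average error probability `P_err(C, σ)` against the jammer state `σ` on `J^ℓ`. -/
def errorProb (N : Channel (A × J) B) {ℓ M : ℕ} (C : ClassicalCode A B ℓ M)
    (σ : State (Fin ℓ → J)) : ℝ :=
  (1 / M : ℝ) * ∑ m, (Matrix.trace
    (tensorPower N.map ℓ ((C.encoder m).mat ⊗ₖ σ.mat) * (1 - C.decoder m))).re

/-- Deterministic quantum codes of dimension `L` for block length `ℓ`. -/
structure QuantumCode (A B : Type*) [Fintype A] [Fintype B] (ℓ L : ℕ) where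
  encoder : Channel (Fin L) (Fin ℓ → A)
  decoder : Channel (Fin ℓ → B) (Fin L)

/-- The maximally entangled state `Φ_L = (1/L) ∑_{i,j} |ii⟩⟨jj|`. -/
def maxEntangled (L : ℕ) : Matrix (Fin L × Fin L) (Fin L × Fin L) ℂ :=
  (1 / L : ℂ) • ∑ i : Fin L, ∑ j : Fin L, Matrix.single (i, i) (j, j) 1

/-- The infidelity `F̂(Q, σ) = 1 - tr (((id ⊗ D ∘ (N^{⊗ℓ})_σ ∘ E) Φ_L) · Φ_L)` against the
jammer state `σ` on `J^ℓ`. -/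
def infidelity (N : Channel (A × J) B) {ℓ L : ℕ} (Q : QuantumCode A B ℓ L)
    (σ : State (Fin ℓ → J)) : ℝ :=
  1 - (Matrix.trace (idTensor (Fin L)
    (Q.decoder.map ∘ₗ fixSecond (tensorPower N.map ℓ) σ.mat ∘ₗ Q.encoder.map)
    (maxEntangled L) * maxEntangled L)).re

end

/-- A random code with values in a set of deterministic codes whose error against a jammer state
`σ : S` is measured by `err`: a probability distribution on `Λ` and a family of deterministic
codes indexed by `Λ`, such that the error against each jammer state is a random variable. -/
structure RandomCode {Code S : Type*} (err : Code → S → ℝ) (Λ : Type*) [MeasurableSpace Λ] where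
  law : MeasureTheory.Measure Λ
  isProbabilityMeasure : MeasureTheory.IsProbabilityMeasure law
  code : Λ → Code
  aemeasurable_err : ∀ σ, AEMeasurable (fun x => err (code x) σ) law

/-- `sup_σ E_λ err(C_λ, σ) ≤ ε`. -/
def RandomCode.HasError {Code S : Type*} {err : Code → S → ℝ} {Λ : Type*} [MeasurableSpace Λ]
    (C : RandomCode err Λ) (ε : ℝ) : Prop :=
  ∀ σ, ∫ x, err (C.code x) σ ∂C.law ≤ ε

/-- The random code `(C_{λ_ν})` with `ν` uniformly distributed on `n` elements. -/
def RandomCode.select {Code S : Type*} {err : Code → S → ℝ} {Λ : Type*} [MeasurableSpace Λ]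
    (C : RandomCode err Λ) {n : ℕ} [NeZero n] (lam : Fin n → Λ) : RandomCode err (Fin n) where
  law := (PMF.uniformOfFintype (Fin n)).toMeasure
  isProbabilityMeasure := inferInstance
  code := fun ν => C.code (lam ν)
  aemeasurable_err := fun _ => Measurable.of_discrete.aemeasurable

/-- Random classical codes of block length `ℓ` with `M` messages for `N`. -/
abbrev RandomClassicalCode {A B J : Type*} [Fintype A] [DecidableEq A] [Fintype B]
    [DecidableEq B] [Fintype J] [DecidableEq J] (N : Channel (A × J) B) (ℓ M : ℕ)
    (Λ : Type*) [MeasurableSpace Λ] :=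
  RandomCode (errorProb N (ℓ := ℓ) (M := M)) Λ

/-- Random quantum codes of block length `ℓ` and dimension `L` for `N`. -/
abbrev RandomQuantumCode {A B J : Type*} [Fintype A] [DecidableEq A] [Fintype B]
    [DecidableEq B] [Fintype J] [DecidableEq J] (N : Channel (A × J) B) (ℓ L : ℕ)
    (Λ : Type*) [MeasurableSpace Λ] :=
  RandomCode (infidelity N (ℓ := ℓ) (L := L)) Λ

end QAVC

end

/-! The error of a code against a jammer state `σ` is `tr (σ X)` for an effect `0 ≤ X ≤ 1` that
depends on the code alone. Codes are chosen greedily: the next effect `X` has expectation at most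
`ε` in the Gibbs state of `S`, where `S` is `t` times the sum of the effects chosen so far; it
exists because the average expectation is at most `ε`. By
`tr exp (S + t X) ≤ tr exp S + (exp t - 1) tr (X exp S)` and Hoeffding's lemma, each choice
multiplies `tr exp S` by at most `exp (t ε + t ^ 2 / 8)`. As `tr (σ S) ≤ log tr exp S` for every
state `σ`, the errors of `n` codes sum to at most `(log d) / t + n (ε + t / 8)` against all `σ`
simultaneously, and `t = 4 δ` makes this at most `n (ε + δ)` once `log d ≤ 2 δ ^ 2 n`.

The trace inequality is a consequence of the Golden-Thompson inequality, but has a more elementary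
proof: `p s = tr (X exp (S + s X))` is the derivative of `tr exp (S + s X)` and satisfies `p' ≤ p`
because `X ^ 2 ≤ X`. In place of derivatives of matrix functions, the argument uses difference
inequalities, which are scalar inequalities averaged over pairs of eigenvectors. -/

namespace QAVC

open Filter Topology

section TraceInequalities

variable {𝕜 P : Type*} [RCLike 𝕜] [Fintype P]

open scoped MatrixOrder in
lemma re_trace_mul_nonneg {X Y : Matrix P P 𝕜} (hX : X.PosSemidef) (hY : Y.PosSemidef) :
    0 ≤ RCLike.re (X * Y).trace := by
  classical
  obtain ⟨B, rfl⟩ := CStarAlgebra.nonneg_iff_eq_star_mul_self.1 hY.nonneg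
  rw [← Matrix.mul_assoc, Matrix.trace_mul_comm, ← Matrix.mul_assoc]
  exact (RCLike.nonneg_iff.1 (hX.mul_mul_conjTranspose_same B).trace_nonneg).1

variable [DecidableEq P] {H K : Matrix P P 𝕜}

/-- The sum of `F λ μ * |⟨u, v⟩|²` over the eigenpairs `(λ, u)` of `H` and `(μ, v)` of `K`. It is
linear and monotone in `F`, so it turns inequalities between functions of two real variables into
trace inequalities. -/
noncomputable def eigenpairSum (hH : H.IsHermitian) (hK : K.IsHermitian) (F : ℝ → ℝ → ℝ) : ℝ :=
  ∑ i, ∑ j, F (hH.eigenvalues i) (hK.eigenvalues j) *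
    ‖(star (hH.eigenvectorUnitary : Matrix P P 𝕜) * hK.eigenvectorUnitary) i j‖ ^ 2

lemma cfc_mul_cfc (f g : ℝ → ℝ) (H : Matrix P P 𝕜) :
    cfc f H * cfc g H = cfc (fun x => f x * g x) H :=
  (cfc_mul f g H (H.finite_real_spectrum.continuousOn f)
    (H.finite_real_spectrum.continuousOn g)).symm

lemma self_mul_cfc (hH : H.IsHermitian) (f : ℝ → ℝ) : H * cfc f H = cfc (fun x => x * f x) H := by
  simpa only [cfc_id' ℝ H hH.isSelfAdjoint] using cfc_mul_cfc (fun x => x) f H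

lemma cfc_mul_self (hH : H.IsHermitian) (f : ℝ → ℝ) : cfc f H * H = cfc (fun x => x * f x) H := by
  simpa only [cfc_id' ℝ H hH.isSelfAdjoint, mul_comm] using cfc_mul_cfc f (fun x => x) H

section EigenpairSum

variable (hH : H.IsHermitian) (hK : K.IsHermitian)

lemma eigenpairSum_mono {F G : ℝ → ℝ → ℝ} (hFG : ∀ x y, F x y ≤ G x y) :
    eigenpairSum hH hK F ≤ eigenpairSum hH hK G :=
  Finset.sum_le_sum fun _ _ => Finset.sum_le_sum fun _ _ =>
    mul_le_mul_of_nonneg_right (hFG _ _) (sq_nonneg _)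

lemma eigenpairSum_add (F G : ℝ → ℝ → ℝ) :
    eigenpairSum hH hK (fun x y => F x y + G x y) =
      eigenpairSum hH hK F + eigenpairSum hH hK G := by
  simp only [eigenpairSum, add_mul, Finset.sum_add_distrib]

lemma eigenpairSum_const_mul (c : ℝ) (F : ℝ → ℝ → ℝ) :
    eigenpairSum hH hK (fun x y => c * F x y) = c * eigenpairSum hH hK F := by
  simp only [eigenpairSum, Finset.mul_sum, mul_assoc]

lemma eigenpairSum_sub (F G : ℝ → ℝ → ℝ) :
    eigenpairSum hH hK (fun x y => F x y - G x y) =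
      eigenpairSum hH hK F - eigenpairSum hH hK G := by
  simp only [eigenpairSum, sub_mul, Finset.sum_sub_distrib]

lemma eigenpairSum_swap (F : ℝ → ℝ → ℝ) :
    eigenpairSum hK hH (fun y x => F x y) = eigenpairSum hH hK F := by
  rw [eigenpairSum, Finset.sum_comm, eigenpairSum]
  refine Finset.sum_congr rfl fun i _ => Finset.sum_congr rfl fun j _ => ?_
  rw [← norm_star, ← Matrix.star_apply, star_mul, star_star]

lemma eigenpairSum_mul (f g : ℝ → ℝ) :
    eigenpairSum hH hK (fun x y => f x * g y) = RCLike.re (cfc f H * cfc g K).trace := by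
  set U := (hH.eigenvectorUnitary : Matrix P P 𝕜)
  set V := (hK.eigenvectorUnitary : Matrix P P 𝕜)
  set D : Matrix P P 𝕜 := Matrix.diagonal (RCLike.ofReal ∘ f ∘ hH.eigenvalues)
  set E : Matrix P P 𝕜 := Matrix.diagonal (RCLike.ofReal ∘ g ∘ hK.eigenvalues)
  have hcycle : (cfc f H * cfc g K).trace = (D * (star U * V) * E * star (star U * V)).trace := by
    rw [hH.cfc_eq, hK.cfc_eq, Matrix.IsHermitian.cfc, Matrix.IsHermitian.cfc,
      Unitary.conjStarAlgAut_apply, Unitary.conjStarAlgAut_apply, star_mul, star_star]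
    simp only [Matrix.mul_assoc]
    rw [Matrix.trace_mul_comm]
    simp only [Matrix.mul_assoc, U, V, D, E]
  rw [hcycle, eigenpairSum, Matrix.trace, map_sum]
  refine Finset.sum_congr rfl fun i _ => ?_
  rw [Matrix.diag_apply, Matrix.mul_apply, map_sum]
  refine Finset.sum_congr rfl fun j _ => ?_
  rw [Matrix.mul_diagonal, Matrix.diagonal_mul, Matrix.star_apply, RCLike.star_def,
    mul_assoc _ _ (starRingEnd 𝕜 _), mul_mul_mul_comm, RCLike.mul_conj]
  simp only [Function.comp_apply]
  norm_cast

lemma eigenpairSum_right (g : ℝ → ℝ) :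
    eigenpairSum hH hK (fun _ y => g y) = RCLike.re (cfc g K).trace := by
  simpa only [one_mul, cfc_const_one ℝ H] using eigenpairSum_mul hH hK (fun _ => 1) g

lemma eigenpairSum_left (f : ℝ → ℝ) :
    eigenpairSum hH hK (fun x _ => f x) = RCLike.re (cfc f H).trace := by
  rw [← eigenpairSum_swap, eigenpairSum_right]

lemma eigenpairSum_sub_mul_right (g : ℝ → ℝ) :
    eigenpairSum hH hK (fun x y => (y - x) * g y) =
      RCLike.re ((K - H) * cfc g K).trace := by
  simp only [sub_mul, eigenpairSum_sub, Matrix.trace_sub, map_sub]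
  rw [eigenpairSum_mul hH hK (fun x => x), eigenpairSum_right hH hK (fun y => y * g y),
    cfc_id' ℝ H hH.isSelfAdjoint, self_mul_cfc hK]

lemma eigenpairSum_sub_mul_left (f : ℝ → ℝ) :
    eigenpairSum hH hK (fun x y => (y - x) * f x) =
      RCLike.re ((K - H) * cfc f H).trace := by
  have hneg := eigenpairSum_const_mul hK hH (-1) fun y x => (x - y) * f x
  rw [eigenpairSum_sub_mul_right] at hneg
  rw [← eigenpairSum_swap]
  simpa only [neg_one_mul, ← neg_mul, neg_sub, ← map_neg, ← Matrix.trace_neg] using hneg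

lemma eigenpairSum_sq_sub_mul_right (g : ℝ → ℝ) :
    eigenpairSum hH hK (fun x y => (y - x) ^ 2 * g y) =
      RCLike.re ((K - H) * (K - H) * cfc g K).trace := by
  have hpoly : (fun x y => (y - x) ^ 2 * g y) =
      fun x y => (y - x) * (y * g y) - (x * (y * g y) - x ^ 2 * g y) := by
    funext x y
    ring
  have hcycle : (K * H * cfc g K).trace = (H * cfc (fun y => y * g y) K).trace := by
    rw [Matrix.mul_assoc, Matrix.trace_mul_comm, Matrix.mul_assoc, cfc_mul_self hK]
  rw [hpoly, eigenpairSum_sub, eigenpairSum_sub, eigenpairSum_sub_mul_right hH hK fun y => y * g y,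
    eigenpairSum_mul hH hK (fun x => x) fun y => y * g y, eigenpairSum_mul hH hK (fun x => x ^ 2),
    cfc_id' ℝ H hH.isSelfAdjoint, cfc_pow_id H 2 hH.isSelfAdjoint, ← hcycle, ← self_mul_cfc hK]
  simp only [sub_mul, mul_sub, sq, Matrix.mul_assoc, Matrix.trace_sub, map_sub]

lemma eigenpairSum_sq_sub_mul_left (f : ℝ → ℝ) :
    eigenpairSum hH hK (fun x y => (y - x) ^ 2 * f x) =
      RCLike.re ((K - H) * (K - H) * cfc f H).trace := by
  rw [← neg_sub H K, neg_mul_neg, ← eigenpairSum_sq_sub_mul_right hK hH, ← eigenpairSum_swap]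
  simp only [sub_sq_comm]

end EigenpairSum

lemma klein_inequality (hH : H.IsHermitian) (hK : K.IsHermitian)
    {f f' : ℝ → ℝ} (hf : ∀ x y, f y - f x ≤ (y - x) * f' y) :
    RCLike.re (cfc f K).trace - RCLike.re (cfc f H).trace ≤
      RCLike.re ((K - H) * cfc f' K).trace := by
  rw [← eigenpairSum_right hH hK, ← eigenpairSum_left hH hK, ← eigenpairSum_sub,
    ← eigenpairSum_sub_mul_right hH hK]
  exact eigenpairSum_mono hH hK hf

lemma re_trace_sub_mul_cfc_sub_le (hH : H.IsHermitian) (hK : K.IsHermitian) {f : ℝ → ℝ}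
    (hf : ∀ x y, (y - x) * (f y - f x) ≤ (y - x) ^ 2 * ((f x + f y) / 2)) :
    RCLike.re ((K - H) * cfc f K).trace - RCLike.re ((K - H) * cfc f H).trace ≤
      (RCLike.re ((K - H) * (K - H) * cfc f H).trace +
        RCLike.re ((K - H) * (K - H) * cfc f K).trace) / 2 := by
  rw [← eigenpairSum_sub_mul_right hH hK, ← eigenpairSum_sub_mul_left hH hK,
    ← eigenpairSum_sq_sub_mul_right hH hK, ← eigenpairSum_sq_sub_mul_left hH hK,
    ← eigenpairSum_sub, ← eigenpairSum_add, div_eq_inv_mul, ← eigenpairSum_const_mul]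
  refine eigenpairSum_mono hH hK fun x y => ?_
  linarith [hf x y]

end TraceInequalities

section Exponential

variable {f : ℝ → ℝ} {q : ℝ → ℝ → ℝ}

lemma frequently_slope_lt (hf : ∀ x y, x < y → f y - f x ≤ (y - x) * q x y)
    {x r : ℝ} (hq : Continuous (q x)) (hr : q x x < r) : ∃ᶠ y in 𝓝[>] x, slope f x y < r := by
  refine Eventually.frequently ?_
  filter_upwards [self_mem_nhdsWithin, nhdsWithin_le_nhds (hq.continuousAt.eventually_lt_const hr)]
    with y hxy hy
  rw [slope_def_field]
  exact ((div_le_iff₀' (sub_pos.2 hxy)).2 (hf x y hxy)).trans_lt hy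

lemma le_exp_mul_of_sub_le (hf : Continuous f)
    (hfq : ∀ x y, x < y → f y - f x ≤ (y - x) * ((f x + f y) / 2)) {t : ℝ} (ht : 0 ≤ t) :
    f t ≤ f 0 * Real.exp t := by
  have hgronwall := le_gronwallBound_of_liminf_deriv_right_le (f' := f) (K := 1) (ε := 0)
    hf.continuousOn (fun x _ r hr => frequently_slope_lt hfq (by fun_prop) (by linarith)) le_rfl
    (fun x _ => by simp) t (Set.right_mem_Icc.2 ht)
  simpa only [gronwallBound_ε0, one_mul, sub_zero] using hgronwall

lemma le_add_exp_sub_one_mul_of_sub_le {p : ℝ → ℝ} {c : ℝ} (hf : Continuous f) (hp : Continuous p)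
    (hfp : ∀ x y, x < y → f y - f x ≤ (y - x) * p y) (hpc : ∀ x, 0 ≤ x → p x ≤ c * Real.exp x)
    {t : ℝ} (ht : 0 ≤ t) : f t ≤ f 0 + (Real.exp t - 1) * c := by
  have hB (x : ℝ) : HasDerivAt (fun x => f 0 + (Real.exp x - 1) * c) (c * Real.exp x) x :=
    ((((Real.hasDerivAt_exp x).sub_const 1).mul_const c).const_add _).congr_deriv (mul_comm _ _)
  exact image_le_of_liminf_slope_right_le_deriv_boundary hf.continuousOn (by simp)
    (fun x _ => (hB x).continuousAt.continuousWithinAt) (fun x _ => (hB x).hasDerivWithinAt)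
    (fun x hx r hr => frequently_slope_lt (q := fun _ => p) hfp hp ((hpc x hx.1).trans_lt hr))
    (Set.right_mem_Icc.2 ht)

lemma exp_sub_exp_le (x y : ℝ) : Real.exp y - Real.exp x ≤ (y - x) * Real.exp y := by
  have hexp : Real.exp x = Real.exp (x - y) * Real.exp y := by rw [← Real.exp_add, sub_add_cancel]
  nlinarith [Real.add_one_le_exp (x - y), Real.exp_pos y]

lemma sub_two_mul_exp_add_nonneg {u : ℝ} (hu : 0 ≤ u) : 0 ≤ (u - 2) * Real.exp u + (u + 2) := by
  have hderiv (u : ℝ) : HasDerivAt (fun u => (u - 2) * Real.exp u + (u + 2))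
      ((u - 1) * Real.exp u + 1) u := by
    refine ((((hasDerivAt_id' u).sub_const 2).mul (Real.hasDerivAt_exp u)).add
      ((hasDerivAt_id' u).add_const 2)).congr_deriv ?_
    ring
  have hmono : Monotone fun u : ℝ => (u - 2) * Real.exp u + (u + 2) := by
    refine monotone_of_deriv_nonneg (fun u => (hderiv u).differentiableAt) fun u => ?_
    have htangent := exp_sub_exp_le 0 u
    rw [Real.exp_zero] at htangent
    rw [(hderiv u).deriv]
    linarith
  simpa using hmono hu

/-- The logarithmic mean of two exponentials is at most their arithmetic mean. -/
lemma sub_mul_exp_sub_exp_le (x y : ℝ) :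
    (y - x) * (Real.exp y - Real.exp x) ≤ (y - x) ^ 2 * ((Real.exp x + Real.exp y) / 2) := by
  wlog hxy : x ≤ y generalizing x y
  · linarith [this y x (le_of_not_ge hxy)]
  have hexp : Real.exp y = Real.exp (y - x) * Real.exp x := by rw [← Real.exp_add, sub_add_cancel]
  have hnonneg := mul_nonneg (mul_nonneg (sub_nonneg.2 hxy) (Real.exp_pos x).le)
    (sub_two_mul_exp_add_nonneg (sub_nonneg.2 hxy))
  rw [hexp]
  linarith

open ProbabilityTheory in
/-- Hoeffding's lemma for a Bernoulli variable. -/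
lemma one_add_exp_sub_one_mul_le {μ : ℝ} (hμ : μ ∈ Set.Icc (0 : ℝ) 1) (t : ℝ) :
    1 + (Real.exp t - 1) * μ ≤ Real.exp (t * μ + t ^ 2 / 8) := by
  set P := bernoulliMeasure (1 : ℝ) 0 ⟨μ, hμ⟩
  have hmem : ∀ᵐ x ∂P, id x ∈ Set.Icc (0 : ℝ) 1 :=
    (MeasureTheory.mem_ae_iff_prob_eq_one measurableSet_Icc).2
      (bernoulliMeasure_apply_of_mem_of_mem _ measurableSet_Icc (by simp) (by simp))
  have hmgf := (hasSubgaussianMGF_of_mem_Icc measurable_id.aemeasurable hmem).mgf_le t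
  rw [mgf, integral_bernoulliMeasure, integral_bernoulliMeasure] at hmgf
  calc 1 + (Real.exp t - 1) * μ
      = Real.exp (t * μ) * (μ * Real.exp (t * (1 - μ)) + (1 - μ) * Real.exp (t * -μ)) := by
        rw [mul_add, mul_left_comm, ← Real.exp_add, mul_left_comm, ← Real.exp_add]
        ring_nf
        rw [Real.exp_zero]
        ring
    _ ≤ Real.exp (t * μ) * Real.exp (t ^ 2 / 8) := by
        refine mul_le_mul_of_nonneg_left (le_of_eq_of_le ?_ (hmgf.trans_eq ?_)) (Real.exp_pos _).le
        · simp
        · congr 1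
          simp
          ring
    _ = Real.exp (t * μ + t ^ 2 / 8) := (Real.exp_add _ _).symm

end Exponential

section Effects

variable {𝕜 P : Type*} [RCLike 𝕜] {S X : Matrix P P 𝕜}

lemma isHermitian_add_smul (hS : S.IsHermitian) (hX : X.IsHermitian) (t : ℝ) :
    (S + t • X).IsHermitian :=
  hS.add ((IsSelfAdjoint.all t).smul hX)

lemma isHermitian_smul_sum {ι : Type*} [Fintype ι] (t : ℝ) {X : ι → Matrix P P 𝕜}
    (hX : ∀ i, (X i).IsHermitian) : (t • ∑ i, X i).IsHermitian :=
  (IsSelfAdjoint.all t).smul (isSelfAdjoint_sum _ fun i _ => hX i)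

variable [Fintype P] [DecidableEq P]

/-- An effect, that is, an element `0 ≤ X ≤ 1` of a two-outcome measurement. -/
structure IsEffect (X : Matrix P P 𝕜) : Prop where
  posSemidef : X.PosSemidef
  one_sub_posSemidef : (1 - X).PosSemidef

lemma IsEffect.sub_mul_self_posSemidef (hX : IsEffect X) : (X - X * X).PosSemidef := by
  have hleft := hX.one_sub_posSemidef.mul_mul_conjTranspose_same X
  have hright := hX.posSemidef.mul_mul_conjTranspose_same (1 - X)
  rw [hX.posSemidef.isHermitian.eq] at hleft
  rw [hX.one_sub_posSemidef.isHermitian.eq] at hright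
  convert hleft.add hright using 1
  noncomm_ring

open scoped MatrixOrder in
lemma cfc_exp_posSemidef (H : Matrix P P 𝕜) : (cfc Real.exp H).PosSemidef :=
  Matrix.nonneg_iff_posSemidef.1 (cfc_nonneg fun x _ => (Real.exp_pos x).le)

open scoped Matrix.Norms.Operator in
lemma continuous_cfc_exp_add_smul (hS : S.IsHermitian) (hX : X.IsHermitian) :
    Continuous fun s : ℝ => cfc Real.exp (S + s • X) := by
  let _ : NormedAlgebra ℚ (Matrix P P 𝕜) := NormedAlgebra.restrictScalars ℚ ℝ _
  -- Instance search does not identify the topology of the norm with the one on matrices.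
  have hexp (s : ℝ) : cfc Real.exp (S + s • X) = NormedSpace.exp (S + s • X) :=
    @CFC.real_exp_eq_normedSpace_exp _ _ _ _ Matrix.IsHermitian.instContinuousFunctionalCalculus _
      (isHermitian_add_smul hS hX s).isSelfAdjoint
  simp only [hexp]
  fun_prop

lemma IsEffect.re_trace_mul_self_mul_cfc_exp_le (hX : IsEffect X) (H : Matrix P P 𝕜) :
    RCLike.re (X * X * cfc Real.exp H).trace ≤ RCLike.re (X * cfc Real.exp H).trace := by
  have hnonneg := re_trace_mul_nonneg hX.sub_mul_self_posSemidef (cfc_exp_posSemidef H)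
  rwa [sub_mul, Matrix.trace_sub, map_sub, sub_nonneg] at hnonneg

lemma IsEffect.re_trace_cfc_exp_add_smul_le (hX : IsEffect X) (hS : S.IsHermitian) {t : ℝ}
    (ht : 0 ≤ t) :
    RCLike.re (cfc Real.exp (S + t • X)).trace ≤ RCLike.re (cfc Real.exp S).trace +
      (Real.exp t - 1) * RCLike.re (X * cfc Real.exp S).trace := by
  have hherm := isHermitian_add_smul hS hX.posSemidef.isHermitian
  have hcont := continuous_cfc_exp_add_smul hS hX.posSemidef.isHermitian
  have hsub (x y : ℝ) : S + y • X - (S + x • X) = (y - x) • X := by rw [sub_smul]; abel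
  set g : ℝ → ℝ := fun s => RCLike.re (cfc Real.exp (S + s • X)).trace
  set p : ℝ → ℝ := fun s => RCLike.re (X * cfc Real.exp (S + s • X)).trace
  have hg : Continuous g := RCLike.continuous_re.comp hcont.matrix_trace
  have hp : Continuous p := RCLike.continuous_re.comp (continuous_const.mul hcont).matrix_trace
  have hgp (x y : ℝ) : g y - g x ≤ (y - x) * p y := by
    simpa only [hsub, Matrix.smul_mul, Matrix.trace_smul, RCLike.smul_re] using
      klein_inequality (hherm x) (hherm y) exp_sub_exp_le
  have hpp (x y : ℝ) (hxy : x < y) : p y - p x ≤ (y - x) * ((p x + p y) / 2) := by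
    have hmean := re_trace_sub_mul_cfc_sub_le (hherm x) (hherm y) sub_mul_exp_sub_exp_le
    simp only [hsub, Matrix.smul_mul, Matrix.mul_smul, Matrix.trace_smul, RCLike.smul_re] at hmean
    have hx := hX.re_trace_mul_self_mul_cfc_exp_le (S + x • X)
    have hy := hX.re_trace_mul_self_mul_cfc_exp_le (S + y • X)
    have hpos := sub_pos.2 hxy
    refine le_of_mul_le_mul_left ?_ hpos
    calc (y - x) * (p y - p x) ≤ _ := (mul_sub _ _ _).trans_le hmean
      _ ≤ ((y - x) * ((y - x) * p x) + (y - x) * ((y - x) * p y)) / 2 := by gcongr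
      _ = (y - x) * ((y - x) * ((p x + p y) / 2)) := by ring
  have hbound := le_add_exp_sub_one_mul_of_sub_le hg hp (fun x y _ => hgp x y)
    (fun s hs => le_exp_mul_of_sub_le hp hpp hs) ht
  simpa only [g, p, zero_smul, add_zero] using hbound

lemma re_trace_cfc {H : Matrix P P 𝕜} (hH : H.IsHermitian) (f : ℝ → ℝ) :
    RCLike.re (cfc f H).trace = ∑ i, f (hH.eigenvalues i) := by
  rw [hH.cfc_eq, Matrix.IsHermitian.cfc, Unitary.conjStarAlgAut_apply, Matrix.trace_mul_comm,
    ← Matrix.mul_assoc, Unitary.coe_star_mul_self, one_mul, Matrix.trace_diagonal, map_sum]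
  simp only [Function.comp_apply, RCLike.ofReal_re]

lemma re_trace_cfc_exp_pos [Nonempty P] {H : Matrix P P 𝕜} (hH : H.IsHermitian) :
    0 < RCLike.re (cfc Real.exp H).trace := by
  rw [re_trace_cfc hH]
  exact Finset.sum_pos (fun _ _ => Real.exp_pos _) Finset.univ_nonempty

lemma eigenvalues_le_log_re_trace_cfc_exp {H : Matrix P P 𝕜} (hH : H.IsHermitian) (i : P) :
    hH.eigenvalues i ≤ Real.log (RCLike.re (cfc Real.exp H).trace) := by
  have : Nonempty P := ⟨i⟩
  rw [Real.le_log_iff_exp_le (re_trace_cfc_exp_pos hH), re_trace_cfc hH]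
  exact Finset.single_le_sum (f := fun i => Real.exp (hH.eigenvalues i))
    (fun _ _ => (Real.exp_pos _).le) (Finset.mem_univ i)

open scoped MatrixOrder in
lemma log_re_trace_cfc_exp_smul_one_sub_posSemidef {H : Matrix P P 𝕜} (hH : H.IsHermitian) :
    (Real.log (RCLike.re (cfc Real.exp H).trace) • (1 : Matrix P P 𝕜) - H).PosSemidef := by
  rw [← Matrix.le_iff, ← Algebra.algebraMap_eq_smul_one]
  refine le_algebraMap_of_spectrum_le (fun x hx => ?_) hH.isSelfAdjoint
  rw [hH.spectrum_real_eq_range_eigenvalues] at hx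
  obtain ⟨i, rfl⟩ := hx
  exact eigenvalues_le_log_re_trace_cfc_exp hH i

end Effects

section States

variable {P : Type*} [Fintype P]

/-- The expectation `tr (σ X)` of an observable `X` in the state `σ`. Only the real part of the
trace is recorded, which loses nothing for Hermitian `X`. -/
noncomputable def State.expect (σ : State P) (X : Matrix P P ℂ) : ℝ :=
  (σ.mat * X).trace.re

lemma State.expect_add (σ : State P) (X Y : Matrix P P ℂ) :
    σ.expect (X + Y) = σ.expect X + σ.expect Y := by
  rw [expect, mul_add, Matrix.trace_add, Complex.add_re, expect, expect]

lemma State.expect_smul (σ : State P) (t : ℝ) (X : Matrix P P ℂ) :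
    σ.expect (t • X) = t * σ.expect X := by
  rw [expect, Matrix.mul_smul, Matrix.trace_smul, Complex.smul_re, smul_eq_mul, expect]

lemma State.expect_sub (σ : State P) (X Y : Matrix P P ℂ) :
    σ.expect (X - Y) = σ.expect X - σ.expect Y := by
  rw [expect, mul_sub, Matrix.trace_sub, Complex.sub_re, expect, expect]

lemma State.expect_sum {ι : Type*} (s : Finset ι) (σ : State P) (X : ι → Matrix P P ℂ) :
    σ.expect (∑ i ∈ s, X i) = ∑ i ∈ s, σ.expect (X i) := by
  simp only [expect, Matrix.mul_sum, Matrix.trace_sum, Complex.re_sum]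

/-- The state `Y / tr Y` proportional to a nonzero positive semidefinite matrix `Y`. -/
noncomputable def State.normalize {Y : Matrix P P ℂ} (hY : Y.PosSemidef) (hY0 : Y ≠ 0) :
    State P where
  mat := Y.trace⁻¹ • Y
  posSemidef := hY.smul (inv_nonneg.2 hY.trace_nonneg)
  trace_eq_one := by
    rw [Matrix.trace_smul, smul_eq_mul, inv_mul_cancel₀ (hY.trace_eq_zero_iff.not.2 hY0)]

lemma re_trace_mul_eq_mul_expect_normalize {Y : Matrix P P ℂ} (hY : Y.PosSemidef) (hY0 : Y ≠ 0)
    (X : Matrix P P ℂ) :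
    (Y * X).trace.re = Y.trace.re * (State.normalize hY hY0).expect X := by
  obtain ⟨r, hr⟩ : ∃ r : ℝ, Y.trace = r :=
    ⟨_, Complex.eq_re_of_ofReal_le (r := 0) (by simpa using hY.trace_nonneg)⟩
  have hr0 : r ≠ 0 := fun h => hY0 (hY.trace_eq_zero_iff.1 (by rw [hr, h, Complex.ofReal_zero]))
  rw [State.expect, State.normalize, Matrix.smul_mul, Matrix.trace_smul, hr, ← Complex.ofReal_inv,
    smul_eq_mul, Complex.re_ofReal_mul, Complex.ofReal_re, mul_inv_cancel_left₀ hr0]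

lemma State.expect_nonneg (σ : State P) {X : Matrix P P ℂ} (hX : X.PosSemidef) :
    0 ≤ σ.expect X :=
  re_trace_mul_nonneg σ.posSemidef hX

variable [DecidableEq P]

lemma State.expect_one (σ : State P) : σ.expect 1 = 1 := by
  rw [expect, mul_one, σ.trace_eq_one, Complex.one_re]

lemma IsEffect.expect_mem_Icc {X : Matrix P P ℂ} (hX : IsEffect X) (σ : State P) :
    σ.expect X ∈ Set.Icc (0 : ℝ) 1 := by
  have hle := σ.expect_nonneg hX.one_sub_posSemidef
  rw [State.expect_sub, State.expect_one] at hle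
  exact ⟨σ.expect_nonneg hX.posSemidef, by linarith⟩

lemma State.expect_le_log_trace_exp (σ : State P) {H : Matrix P P ℂ} (hH : H.IsHermitian) :
    σ.expect H ≤ Real.log (cfc Real.exp H).trace.re := by
  have hle := σ.expect_nonneg (log_re_trace_cfc_exp_smul_one_sub_posSemidef hH)
  rw [expect_sub, expect_smul, expect_one, mul_one, sub_nonneg] at hle
  exact hle

section Greedy

variable [Nonempty P] {S : Matrix P P ℂ}

lemma cfc_exp_ne_zero (hS : S.IsHermitian) : cfc Real.exp S ≠ 0 := fun h => by
  simpa only [h, Matrix.trace_zero, map_zero, lt_irrefl] using re_trace_cfc_exp_pos hS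

/-- The Gibbs state `exp S / tr exp S`. -/
noncomputable def gibbsState (hS : S.IsHermitian) : State P :=
  State.normalize (cfc_exp_posSemidef S) (cfc_exp_ne_zero hS)

lemma IsEffect.trace_exp_add_smul_le {X : Matrix P P ℂ} (hX : IsEffect X) (hS : S.IsHermitian)
    {ε t : ℝ} (ht : 0 ≤ t) (hε : (gibbsState hS).expect X ≤ ε) :
    (cfc Real.exp (S + t • X)).trace.re ≤
      (cfc Real.exp S).trace.re * Real.exp (t * ε + t ^ 2 / 8) := by
  have hpos : 0 < (cfc Real.exp S).trace.re := re_trace_cfc_exp_pos hS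
  calc (cfc Real.exp (S + t • X)).trace.re
      ≤ (cfc Real.exp S).trace.re + (Real.exp t - 1) * (X * cfc Real.exp S).trace.re :=
        hX.re_trace_cfc_exp_add_smul_le hS ht
    _ = (cfc Real.exp S).trace.re * (1 + (Real.exp t - 1) * (gibbsState hS).expect X) := by
        rw [Matrix.trace_mul_comm, re_trace_mul_eq_mul_expect_normalize (cfc_exp_posSemidef S)
          (cfc_exp_ne_zero hS), gibbsState]
        ring
    _ ≤ (cfc Real.exp S).trace.re * Real.exp (t * (gibbsState hS).expect X + t ^ 2 / 8) := by
        gcongr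
        exact one_add_exp_sub_one_mul_le (hX.expect_mem_Icc _) t
    _ ≤ (cfc Real.exp S).trace.re * Real.exp (t * ε + t ^ 2 / 8) := by gcongr

variable {Λ : Type*} {X : Λ → Matrix P P ℂ}

lemma exists_trace_exp_sum_le (hX : ∀ x, IsEffect (X x)) {ε t : ℝ} (ht : 0 ≤ t)
    (hε : ∀ σ : State P, ∃ x, σ.expect (X x) ≤ ε) (n : ℕ) :
    ∃ lam : Fin n → Λ, (cfc Real.exp (t • ∑ ν, X (lam ν))).trace.re ≤
      Fintype.card P * Real.exp (n * (t * ε + t ^ 2 / 8)) := by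
  induction n with
  | zero => exact ⟨Fin.elim0, by simp [cfc_apply_zero]⟩
  | succ n ih =>
    obtain ⟨lam, hlam⟩ := ih
    have hS := isHermitian_smul_sum t fun ν => (hX (lam ν)).posSemidef.isHermitian
    obtain ⟨x, hx⟩ := hε (gibbsState hS)
    refine ⟨Fin.snoc lam x, ?_⟩
    simp only [Fin.sum_univ_castSucc, Fin.snoc_castSucc, Fin.snoc_last, smul_add]
    calc (cfc Real.exp (t • ∑ ν, X (lam ν) + t • X x)).trace.re
        ≤ (cfc Real.exp (t • ∑ ν, X (lam ν))).trace.re * Real.exp (t * ε + t ^ 2 / 8) :=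
          (hX x).trace_exp_add_smul_le hS ht hx
      _ ≤ Fintype.card P * Real.exp (n * (t * ε + t ^ 2 / 8)) *
            Real.exp (t * ε + t ^ 2 / 8) := by gcongr
      _ = Fintype.card P * Real.exp ((n + 1 : ℕ) * (t * ε + t ^ 2 / 8)) := by
          rw [mul_assoc, ← Real.exp_add, Nat.cast_succ, add_one_mul]

lemma exists_sum_expect_le (hX : ∀ x, IsEffect (X x)) {ε t : ℝ} (ht : 0 ≤ t)
    (hε : ∀ σ : State P, ∃ x, σ.expect (X x) ≤ ε) (n : ℕ) :
    ∃ lam : Fin n → Λ, ∀ σ : State P, t * ∑ ν, σ.expect (X (lam ν)) ≤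
      Real.log (Fintype.card P) + n * (t * ε + t ^ 2 / 8) := by
  obtain ⟨lam, hlam⟩ := exists_trace_exp_sum_le hX ht hε n
  have hS := isHermitian_smul_sum t fun ν => (hX (lam ν)).posSemidef.isHermitian
  refine ⟨lam, fun σ => ?_⟩
  calc t * ∑ ν, σ.expect (X (lam ν)) = σ.expect (t • ∑ ν, X (lam ν)) := by
        rw [State.expect_smul, State.expect_sum]
    _ ≤ Real.log (cfc Real.exp (t • ∑ ν, X (lam ν))).trace.re := σ.expect_le_log_trace_exp hS
    _ ≤ Real.log (Fintype.card P * Real.exp (n * (t * ε + t ^ 2 / 8))) :=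
        Real.log_le_log (re_trace_cfc_exp_pos hS) hlam
    _ = Real.log (Fintype.card P) + n * (t * ε + t ^ 2 / 8) := by
        rw [Real.log_mul (by simp) (Real.exp_pos _).ne', Real.log_exp]

end Greedy

end States

section Functionals

variable {P : Type*} [Fintype P]

lemma exists_isHermitian_re_eq_expect (f : Matrix P P ℂ →ₗ[ℂ] ℂ) :
    ∃ X : Matrix P P ℂ, X.IsHermitian ∧ ∀ σ : State P, (f σ.mat).re = σ.expect X := by
  classical
  set E : Matrix P P ℂ := Matrix.of fun i j => f (Matrix.single j i 1)
  have hf (Y : Matrix P P ℂ) : f Y = (Y * E).trace := by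
    conv_lhs => rw [Matrix.matrix_eq_sum_single Y]
    simp only [map_sum, Matrix.trace, Matrix.diag_apply, Matrix.mul_apply, E, Matrix.of_apply]
    refine Finset.sum_congr rfl fun i _ => Finset.sum_congr rfl fun j _ => ?_
    rw [← smul_eq_mul, ← map_smul, Matrix.smul_single, smul_eq_mul, mul_one]
  have hstar (σ : State P) : σ.expect (star E) = σ.expect E := by
    rw [State.expect, State.expect, ← Complex.conj_re (σ.mat * E).trace, ← Complex.star_def,
      ← Matrix.trace_conjTranspose, Matrix.conjTranspose_mul, σ.posSemidef.isHermitian.eq,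
      Matrix.trace_mul_comm, Matrix.star_eq_conjTranspose]
  refine ⟨(2⁻¹ : ℝ) • (E + star E), (IsSelfAdjoint.all _).smul (.add_star_self E), fun σ => ?_⟩
  rw [hf, State.expect_smul, State.expect_add, hstar, ← two_mul, inv_mul_cancel_left₀ two_ne_zero,
    State.expect]

lemma posSemidef_of_expect_nonneg {X : Matrix P P ℂ} (hX : X.IsHermitian)
    (hexpect : ∀ σ : State P, 0 ≤ σ.expect X) : X.PosSemidef := by
  refine .of_dotProduct_mulVec_nonneg hX fun v => Complex.le_def.2 ⟨?_, ?_⟩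
  · have hvec : star v ⬝ᵥ X.mulVec v = (Matrix.vecMulVec v (star v) * X).trace := by
      rw [Matrix.trace_mul_comm, Matrix.mul_vecMulVec, Matrix.trace_vecMulVec, dotProduct_comm]
    have hV := Matrix.posSemidef_vecMulVec_self_star v
    rw [hvec]
    by_cases hV0 : Matrix.vecMulVec v (star v) = 0
    · simp [hV0]
    rw [re_trace_mul_eq_mul_expect_normalize hV hV0]
    exact mul_nonneg (Complex.le_def.1 hV.trace_nonneg).1 (hexpect _)
  · simpa using (hX.im_star_dotProduct_mulVec_self v).symm

variable [DecidableEq P]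

lemma exists_isEffect_re_eq_expect (f : Matrix P P ℂ →ₗ[ℂ] ℂ)
    (hf : ∀ σ : State P, (f σ.mat).re ∈ Set.Icc (0 : ℝ) 1) :
    ∃ X : Matrix P P ℂ, IsEffect X ∧ ∀ σ : State P, (f σ.mat).re = σ.expect X := by
  obtain ⟨X, hX, hfX⟩ := exists_isHermitian_re_eq_expect f
  simp only [hfX] at hf
  refine ⟨X, ⟨posSemidef_of_expect_nonneg hX fun σ => (hf σ).1,
    posSemidef_of_expect_nonneg (Matrix.isHermitian_one.sub hX) fun σ => ?_⟩, hfX⟩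
  rw [State.expect_sub, State.expect_one]
  exact sub_nonneg.2 (hf σ).2

end Functionals

section Channels

variable {P Q R S ι : Type*} [Fintype P]

section Kraus

variable [Fintype ι]

/-- The completely positive map `X ↦ ∑ k, K k X (K k)ᴴ` with Kraus operators `K k`. -/
def krausMap (K : ι → Matrix Q P ℂ) : Matrix P P ℂ →ₗ[ℂ] Matrix Q Q ℂ where
  toFun X := ∑ k, K k * X * (K k).conjTranspose
  map_add' X Y := by simp only [Matrix.mul_add, Matrix.add_mul, Finset.sum_add_distrib]
  map_smul' c X := by
    simp only [Matrix.mul_smul, Matrix.smul_mul, Finset.smul_sum, RingHom.id_apply]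

lemma krausMap_posSemidef [Finite Q] (K : ι → Matrix Q P ℂ) {X : Matrix P P ℂ} (hX : X.PosSemidef) :
    (krausMap K X).PosSemidef :=
  Matrix.posSemidef_sum _ fun k _ => hX.mul_mul_conjTranspose_same (K k)

lemma krausMap_apply_apply (K : ι → Matrix Q P ℂ) (X : Matrix P P ℂ) (b b' : Q) :
    krausMap K X b b' = ∑ x, ∑ y, X x y * ∑ k, K k b x * star (K k b' y) := by
  simp only [krausMap, LinearMap.coe_mk, AddHom.coe_mk, Matrix.sum_apply, Matrix.mul_apply,
    Matrix.conjTranspose_apply, Finset.sum_mul, Finset.mul_sum]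
  rw [Finset.sum_comm_cycle]
  refine Finset.sum_congr rfl fun x _ => ?_
  rw [Finset.sum_comm]
  exact Finset.sum_congr rfl fun y _ => Finset.sum_congr rfl fun k _ => by ring

lemma krausMap_single_apply [DecidableEq P] (K : ι → Matrix Q P ℂ) (x y : P) (b b' : Q) :
    krausMap K (Matrix.single x y 1) b b' = ∑ k, K k b x * star (K k b' y) := by
  simp [krausMap_apply_apply, Matrix.single_apply, ite_and]

lemma idTensor_krausMap [Fintype R] [DecidableEq R] (K : ι → Matrix Q P ℂ) :
    idTensor R (krausMap K) = krausMap fun k => (1 : Matrix R R ℂ) ⊗ₖ K k := by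
  ext X ⟨r, b⟩ ⟨s, b'⟩
  simp [idTensor, krausMap_apply_apply, Fintype.sum_prod_type, Matrix.kroneckerMap_apply,
    Matrix.one_apply, Finset.sum_ite_irrel, apply_ite (starRingEnd ℂ)]

lemma idTensor_krausMap_posSemidef [Finite Q] [Finite R] (K : ι → Matrix Q P ℂ)
    {X : Matrix (R × P) (R × P) ℂ} (hX : X.PosSemidef) :
    (idTensor R (krausMap K) X).PosSemidef := by
  classical
  have := Fintype.ofFinite R
  rw [idTensor_krausMap]
  exact krausMap_posSemidef _ hX

open scoped MatrixOrder in
lemma Channel.exists_krausMap [Fintype Q] (N : Channel P Q) :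
    ∃ K : P × Q → Matrix Q P ℂ, N.map = krausMap K := by
  classical
  set e := Fintype.equivFin P
  set v : Fin (Fintype.card P) × P → ℂ := fun z => if e z.2 = z.1 then 1 else 0
  -- `v` is the vector `∑ i, |ii⟩`, so that `hchoi` concerns the Choi matrix of `N`.
  have hchoi := (N.completelyPositive _ _ (Matrix.posSemidef_vecMulVec_self_star v)).submatrix
    fun z : P × Q => (e z.1, z.2)
  obtain ⟨G, hG⟩ := CStarAlgebra.nonneg_iff_eq_star_mul_self.1 hchoi.nonneg
  refine ⟨fun k => Matrix.of fun b x => star (G k (x, b)), ?_⟩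
  refine Matrix.ext_linearMap _ fun x y => LinearMap.ext_ring (Matrix.ext fun b b' => ?_)
  have hsingle : (Matrix.vecMulVec v (star v)).submatrix (Prod.mk (e x)) (Prod.mk (e y)) =
      Matrix.single x y 1 := by
    ext i j
    simp [v, Matrix.vecMulVec_apply, Matrix.single_apply, ← ite_and, eq_comm, and_comm]
  have hentry := congrFun (congrFun hG (x, b)) (y, b')
  simp only [idTensor, LinearMap.coe_mk, AddHom.coe_mk, Matrix.submatrix_apply, Matrix.of_apply,
    hsingle, Matrix.mul_apply, Matrix.star_apply] at hentry
  simp [krausMap_single_apply, hentry]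

lemma tensorPower_krausMap {A J B : Type*} [Fintype A] [DecidableEq A] [Fintype J] [DecidableEq J]
    (K : ι → Matrix B (A × J) ℂ) (ℓ : ℕ) :
    tensorPower (krausMap K) ℓ = krausMap fun k : Fin ℓ → ι =>
      Matrix.of fun b x => ∏ i, K (k i) (b i) (x.1 i, x.2 i) := by
  ext X b b'
  rw [krausMap_apply_apply]
  simp only [tensorPower, LinearMap.coe_mk, AddHom.coe_mk, Matrix.of_apply,
    krausMap_single_apply, Finset.prod_univ_sum, Fintype.piFinset_univ, Finset.prod_mul_distrib,
    star_prod]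

end Kraus

variable [Fintype Q]

lemma trace_idTensor [Fintype R] {T : Matrix P P ℂ →ₗ[ℂ] Matrix Q Q ℂ}
    (hT : ∀ X, (T X).trace = X.trace) (X : Matrix (R × P) (R × P) ℂ) :
    (idTensor R T X).trace = X.trace := by
  rw [Matrix.trace, Matrix.trace, Fintype.sum_prod_type, Fintype.sum_prod_type]
  exact Finset.sum_congr rfl fun r _ => hT (X.submatrix (Prod.mk r) (Prod.mk r))

lemma trace_tensorPower {A J B : Type*} [Fintype A] [DecidableEq A] [Fintype J] [DecidableEq J]
    [Fintype B] {T : Matrix (A × J) (A × J) ℂ →ₗ[ℂ] Matrix B B ℂ}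
    (hT : ∀ X, (T X).trace = X.trace) (ℓ : ℕ)
    (X : Matrix ((Fin ℓ → A) × (Fin ℓ → J)) ((Fin ℓ → A) × (Fin ℓ → J)) ℂ) :
    (tensorPower T ℓ X).trace = X.trace := by
  have hunit (x y : (Fin ℓ → A) × (Fin ℓ → J)) :
      ∑ b : Fin ℓ → B, ∏ i, T (Matrix.single (x.1 i, x.2 i) (y.1 i, y.2 i) 1) (b i) (b i) =
        if x = y then 1 else 0 := by
    calc _ = ∏ i, (T (Matrix.single (x.1 i, x.2 i) (y.1 i, y.2 i) 1)).trace := by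
          simp only [Matrix.trace, Finset.prod_univ_sum, Fintype.piFinset_univ, Matrix.diag_apply]
      _ = ∏ i, if (x.1 i, x.2 i) = (y.1 i, y.2 i) then 1 else 0 := by
          refine Finset.prod_congr rfl fun i _ => ?_
          rw [hT]
          split_ifs with h
          · rw [h, Matrix.trace_single_eq_same]
          · exact Matrix.trace_single_eq_of_ne _ _ _ h
      _ = if x = y then 1 else 0 := by
          simp only [Fintype.prod_boole, Prod.ext_iff, funext_iff, forall_and]
  simp only [Matrix.trace, Matrix.diag_apply, tensorPower, LinearMap.coe_mk, AddHom.coe_mk,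
    Matrix.of_apply]
  rw [Finset.sum_comm]
  refine Finset.sum_congr rfl fun x _ => ?_
  rw [Finset.sum_comm]
  simp [← Finset.mul_sum, hunit]

lemma Channel.map_posSemidef (N : Channel P Q) {X : Matrix P P ℂ} (hX : X.PosSemidef) :
    (N.map X).PosSemidef := by
  obtain ⟨K, hK⟩ := N.exists_krausMap
  rw [hK]
  exact krausMap_posSemidef K hX

/-- The state `N(ρ)` at the output of the channel `N` on the input state `ρ`. -/
def Channel.onState (N : Channel P Q) (ρ : State P) : State Q where
  mat := N.map ρ.mat
  posSemidef := N.map_posSemidef ρ.posSemidef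
  trace_eq_one := by rw [N.tracePreserving, ρ.trace_eq_one]

/-- The channel `N ∘ M`. -/
def Channel.comp [Fintype R] (N : Channel Q R) (M : Channel P Q) : Channel P R where
  map := N.map ∘ₗ M.map
  completelyPositive k X hX := N.completelyPositive k _ (M.completelyPositive k X hX)
  tracePreserving X := by
    rw [LinearMap.comp_apply, N.tracePreserving, M.tracePreserving]

/-- The channel `id ⊗ N` with a reference system `R`. -/
def Channel.idTensor (R : Type*) [Fintype R] (N : Channel P Q) : Channel (R × P) (R × Q) where
  map := QAVC.idTensor R N.map
  completelyPositive k X hX := by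
    classical
    obtain ⟨K, hK⟩ := N.exists_krausMap
    rw [hK, idTensor_krausMap]
    exact idTensor_krausMap_posSemidef _ hX
  tracePreserving := trace_idTensor N.tracePreserving

/-- The channel `ρ ↦ N(ρ ⊗ σ)` with the state of the second input system fixed to `σ`. -/
def Channel.fixSecond [Fintype S] (N : Channel (P × S) Q) (σ : State S) : Channel P Q where
  map := QAVC.fixSecond N.map σ.mat
  completelyPositive k X hX := N.completelyPositive k _ <|
    (hX.kronecker σ.posSemidef).submatrix fun z : Fin k × (P × S) => ((z.1, z.2.1), z.2.2)
  tracePreserving X :=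
    (N.tracePreserving _).trans (by rw [Matrix.trace_kronecker, σ.trace_eq_one, mul_one])

/-- The channel `N^{⊗ℓ}` given by `ℓ` independent uses of `N`. -/
def Channel.tensorPower {A J B : Type*} [Fintype A] [DecidableEq A] [Fintype J] [DecidableEq J]
    [Fintype B] (N : Channel (A × J) B) (ℓ : ℕ) :
    Channel ((Fin ℓ → A) × (Fin ℓ → J)) (Fin ℓ → B) where
  map := QAVC.tensorPower N.map ℓ
  completelyPositive k X hX := by
    obtain ⟨K, hK⟩ := N.exists_krausMap
    rw [hK, tensorPower_krausMap]
    exact idTensor_krausMap_posSemidef _ hX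
  tracePreserving := trace_tensorPower N.tracePreserving ℓ

end Channels

section Codes

variable {A B J : Type*} [Fintype A] [Fintype B] [Fintype J] {ℓ : ℕ}

section Classical

variable {M : ℕ} [DecidableEq B]

lemma ClassicalCode.isEffect_one_sub_decoder (C : ClassicalCode A B ℓ M) (m : Fin M) :
    IsEffect (1 - C.decoder m) where
  posSemidef := by
    rw [← C.decoder_sum, ← Finset.sum_erase_eq_sub (Finset.mem_univ m)]
    exact Matrix.posSemidef_sum _ fun k _ => C.decoder_posSemidef k
  one_sub_posSemidef := by simpa only [sub_sub_cancel] using C.decoder_posSemidef m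

variable [DecidableEq A] [DecidableEq J]

lemma errorProb_mem_Icc (N : Channel (A × J) B) (C : ClassicalCode A B ℓ M)
    (σ : State (Fin ℓ → J)) : errorProb N C σ ∈ Set.Icc (0 : ℝ) 1 := by
  have hmem (m : Fin M) : (((N.tensorPower ℓ).fixSecond σ).onState (C.encoder m)).expect
      (1 - C.decoder m) ∈ Set.Icc (0 : ℝ) 1 :=
    (C.isEffect_one_sub_decoder m).expect_mem_Icc _
  refine ⟨mul_nonneg (by positivity) (Finset.sum_nonneg fun m _ => (hmem m).1), ?_⟩
  calc errorProb N C σ ≤ (1 / M : ℝ) * ∑ _ : Fin M, 1 :=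
        mul_le_mul_of_nonneg_left (Finset.sum_le_sum fun m _ => (hmem m).2) (by positivity)
    _ ≤ 1 := by
        rw [Finset.sum_const, Finset.card_univ, Fintype.card_fin, nsmul_one, one_div_mul_eq_div]
        exact div_self_le_one _

lemma exists_isEffect_errorProb (N : Channel (A × J) B) (C : ClassicalCode A B ℓ M) :
    ∃ X, IsEffect X ∧ ∀ σ : State (Fin ℓ → J), errorProb N C σ = σ.expect X := by
  set f : Matrix (Fin ℓ → J) (Fin ℓ → J) ℂ →ₗ[ℂ] ℂ :=
    { toFun := fun Y => (1 / M : ℝ) *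
        ∑ m, (tensorPower N.map ℓ ((C.encoder m).mat ⊗ₖ Y) * (1 - C.decoder m)).trace
      map_add' := fun Y Z => by
        simp only [Matrix.kronecker_add, map_add, Matrix.add_mul, Matrix.trace_add,
          Finset.sum_add_distrib, mul_add]
      map_smul' := fun c Y => by
        simp only [Matrix.kronecker_smul, map_smul, Matrix.smul_mul, Matrix.trace_smul,
          ← Finset.smul_sum, mul_smul_comm, RingHom.id_apply] }
  have hf (σ : State (Fin ℓ → J)) : (f σ.mat).re = errorProb N C σ := by
    simp only [f, LinearMap.coe_mk, AddHom.coe_mk, errorProb, Complex.re_ofReal_mul,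
      Complex.re_sum]
  simp only [← hf]
  exact exists_isEffect_re_eq_expect f fun σ => hf σ ▸ errorProb_mem_Icc N C σ

end Classical

section Quantum

variable {L : ℕ}

/-- The unnormalized maximally entangled vector `∑ i, |ii⟩`. -/
def diagonalVec (L : ℕ) : Fin L × Fin L → ℂ := fun z => if z.1 = z.2 then 1 else 0

lemma star_diagonalVec_dotProduct_self (L : ℕ) : star (diagonalVec L) ⬝ᵥ diagonalVec L = L := by
  simp [diagonalVec, dotProduct, Fintype.sum_prod_type, apply_ite]

lemma maxEntangled_eq_smul_vecMulVec (L : ℕ) :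
    maxEntangled L = (L : ℂ)⁻¹ • Matrix.vecMulVec (diagonalVec L) (star (diagonalVec L)) := by
  ext ⟨a, b⟩ ⟨c, d⟩
  by_cases hab : a = b <;> by_cases hcd : c = d <;>
    simp [maxEntangled, Matrix.sum_apply, Matrix.single_apply, Matrix.vecMulVec_apply,
      diagonalVec, hab, hcd, ite_and]

lemma maxEntangled_posSemidef (L : ℕ) : (maxEntangled L).PosSemidef := by
  rw [maxEntangled_eq_smul_vecMulVec]
  exact (Matrix.posSemidef_vecMulVec_self_star _).smul (by positivity)

lemma trace_maxEntangled (L : ℕ) [NeZero L] : (maxEntangled L).trace = 1 := by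
  rw [maxEntangled_eq_smul_vecMulVec, Matrix.trace_smul, Matrix.trace_vecMulVec, dotProduct_comm,
    star_diagonalVec_dotProduct_self, smul_eq_mul, inv_mul_cancel₀ (NeZero.ne _)]

lemma maxEntangled_mul_self (L : ℕ) [NeZero L] :
    maxEntangled L * maxEntangled L = maxEntangled L := by
  rw [maxEntangled_eq_smul_vecMulVec, smul_mul_smul_comm, Matrix.vecMulVec_mul_vecMulVec,
    star_diagonalVec_dotProduct_self, Matrix.vecMulVec_smul, smul_smul,
    inv_mul_cancel_right₀ (NeZero.ne _)]

/-- The maximally entangled state `Φ_L` as a bundled state. -/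
noncomputable def maxEntangledState (L : ℕ) [NeZero L] : State (Fin L × Fin L) where
  mat := maxEntangled L
  posSemidef := maxEntangled_posSemidef L
  trace_eq_one := trace_maxEntangled L

lemma isEffect_maxEntangled (L : ℕ) [NeZero L] : IsEffect (maxEntangled L) where
  posSemidef := maxEntangled_posSemidef L
  one_sub_posSemidef := by
    have hsq := Matrix.posSemidef_conjTranspose_mul_self (1 - maxEntangled L)
    rwa [(Matrix.isHermitian_one.sub (maxEntangled_posSemidef L).isHermitian).eq, sub_mul,
      mul_sub, mul_sub, maxEntangled_mul_self, one_mul, one_mul, mul_one, sub_self,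
      sub_zero] at hsq

variable [DecidableEq A] [DecidableEq J]

lemma infidelity_mem_Icc (N : Channel (A × J) B) (Q : QuantumCode A B ℓ L)
    (σ : State (Fin ℓ → J)) : infidelity N Q σ ∈ Set.Icc (0 : ℝ) 1 := by
  obtain rfl | hL := eq_or_ne L 0
  · simp [infidelity, Matrix.trace]
  have : NeZero L := ⟨hL⟩
  have hmem := (isEffect_maxEntangled L).expect_mem_Icc
    (((Q.decoder.comp (((N.tensorPower ℓ).fixSecond σ).comp Q.encoder)).idTensor (Fin L)).onState
      (maxEntangledState L))
  exact ⟨sub_nonneg.2 hmem.2, sub_le_self _ hmem.1⟩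

lemma exists_isEffect_infidelity (N : Channel (A × J) B) (Q : QuantumCode A B ℓ L) :
    ∃ X, IsEffect X ∧ ∀ σ : State (Fin ℓ → J), infidelity N Q σ = σ.expect X := by
  set T : Matrix (Fin ℓ → J) (Fin ℓ → J) ℂ → Matrix (Fin L × Fin L) (Fin L × Fin L) ℂ :=
    fun Y => idTensor (Fin L)
      (Q.decoder.map ∘ₗ fixSecond (tensorPower N.map ℓ) Y ∘ₗ Q.encoder.map) (maxEntangled L)
  set f : Matrix (Fin ℓ → J) (Fin ℓ → J) ℂ →ₗ[ℂ] ℂ :=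
    { toFun := fun Y => Y.trace - (T Y * maxEntangled L).trace
      map_add' := fun Y Z => by
        have hadd : T (Y + Z) = T Y + T Z := by
          ext x y
          simp [T, idTensor, fixSecond, Matrix.kronecker_add]
        rw [hadd, Matrix.add_mul, Matrix.trace_add, Matrix.trace_add, add_sub_add_comm]
      map_smul' := fun c Y => by
        have hsmul : T (c • Y) = c • T Y := by
          ext x y
          simp [T, idTensor, fixSecond, Matrix.kronecker_smul]
        rw [hsmul, Matrix.smul_mul, Matrix.trace_smul, Matrix.trace_smul, ← smul_sub,
          RingHom.id_apply] }
  have hf (σ : State (Fin ℓ → J)) : (f σ.mat).re = infidelity N Q σ := by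
    simp only [f, LinearMap.coe_mk, AddHom.coe_mk, infidelity, σ.trace_eq_one, Complex.sub_re,
      Complex.one_re, T]
  simp only [← hf]
  exact exists_isEffect_re_eq_expect f fun σ => hf σ ▸ infidelity_mem_Icc N Q σ

end Quantum

end Codes

section Selection

variable {Code S Λ : Type*} [MeasurableSpace Λ] {ε : ℝ}

lemma RandomCode.HasError.exists_err_le {err : Code → S → ℝ} {C : RandomCode err Λ}
    (hC : C.HasError ε) {σ : S} (herr : ∀ c, err c σ ∈ Set.Icc (0 : ℝ) 1) :
    ∃ x, err (C.code x) σ ≤ ε := by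
  have := C.isProbabilityMeasure
  obtain ⟨x, hx⟩ := MeasureTheory.exists_le_integral <|
    MeasureTheory.Integrable.of_mem_Icc 0 1 (C.aemeasurable_err σ) (.of_forall fun _ => herr _)
  exact ⟨x, hx.trans (hC σ)⟩

lemma RandomCode.integral_select {err : Code → S → ℝ} (C : RandomCode err Λ) {n : ℕ} [NeZero n]
    (lam : Fin n → Λ) (σ : S) :
    ∫ ν, err ((C.select lam).code ν) σ ∂(C.select lam).law =
      (n : ℝ)⁻¹ * ∑ ν, err (C.code (lam ν)) σ := by
  rw [select, PMF.integral_eq_sum, Finset.mul_sum]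
  simp

variable {P : Type*} [Fintype P] [DecidableEq P] {err : Code → State P → ℝ} {δ : ℝ}

lemma RandomCode.HasError.exists_select_add {C : RandomCode err Λ} (hC : C.HasError ε)
    (herr : ∀ c, ∃ X, IsEffect X ∧ ∀ σ : State P, err c σ = σ.expect X) (hδ : 0 < δ) (n : ℕ)
    [NeZero n] (hn : Real.log (Fintype.card P) ≤ 2 * δ ^ 2 * n) :
    ∃ lam : Fin n → Λ, (C.select lam).HasError (ε + δ) := by
  have hlaw := C.isProbabilityMeasure
  rcases isEmpty_or_nonempty P with hP | hP
  · obtain ⟨x⟩ := MeasureTheory.nonempty_of_isProbabilityMeasure C.law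
    exact ⟨fun _ => x, fun σ => by simpa [Matrix.trace] using σ.trace_eq_one⟩
  choose X hX hXerr using herr
  have hε (σ : State P) : ∃ x, σ.expect (X (C.code x)) ≤ ε := by
    simpa only [hXerr] using hC.exists_err_le fun c => hXerr c σ ▸ (hX c).expect_mem_Icc σ
  -- `t = 4δ` maximizes `tδ - t²/8`, the gain per code in the exponent.
  obtain ⟨lam, hlam⟩ :=
    exists_sum_expect_le (fun x => hX (C.code x)) (t := 4 * δ) (by positivity) hε n
  refine ⟨lam, fun σ => ?_⟩
  rw [C.integral_select, inv_mul_le_iff₀ (Nat.cast_pos.2 (NeZero.pos n))]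
  refine le_of_mul_le_mul_left ?_ (mul_pos four_pos hδ)
  calc 4 * δ * ∑ ν, err (C.code (lam ν)) σ
      ≤ Real.log (Fintype.card P) + n * (4 * δ * ε + (4 * δ) ^ 2 / 8) := by
        simpa only [hXerr] using hlam σ
    _ ≤ 2 * δ ^ 2 * n + n * (4 * δ * ε + (4 * δ) ^ 2 / 8) := by gcongr
    _ = 4 * δ * (n * (ε + δ)) := by ring

lemma RandomCode.HasError.exists_le_select_add {C : RandomCode err Λ} (hC : C.HasError ε)
    (herr : ∀ c, ∃ X, IsEffect X ∧ ∀ σ : State P, err c σ = σ.expect X) (hδ : 0 < δ) :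
    ∃ (n : ℕ) (_ : NeZero n) (lam : Fin n → Λ),
      (n : ℝ) ≤ 1 + 1 / (2 * δ ^ 2) * Real.log (Fintype.card P) ∧
      (C.select lam).HasError (ε + δ) := by
  set m := 1 / (2 * δ ^ 2) * Real.log (Fintype.card P) with hm
  have hm0 : 0 ≤ m := by positivity
  obtain ⟨lam, hlam⟩ := hC.exists_select_add herr hδ (⌊m⌋₊ + 1) <| by
    calc Real.log (Fintype.card P) = 2 * δ ^ 2 * m := by rw [hm]; field_simp
      _ ≤ 2 * δ ^ 2 * (⌊m⌋₊ + 1 : ℕ) := by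
        push_cast
        gcongr
        exact (Nat.lt_floor_add_one m).le
  refine ⟨_, inferInstance, lam, ?_, hlam⟩
  rw [Nat.cast_succ, add_comm]
  gcongr
  exact Nat.floor_le hm0

lemma isBigO_logb_one_add_mul {c : ℝ} (hc : 0 ≤ c) (b : ℝ) :
    (fun ℓ : ℕ => Real.logb b (1 + c * ℓ)) =O[atTop] fun ℓ : ℕ => Real.log ℓ := by
  simp only [Real.logb, div_eq_inv_mul]
  refine Asymptotics.IsBigO.const_mul_left (.of_bound 2 ?_) _
  filter_upwards [eventually_ge_atTop (⌈1 + c⌉₊ + 1)] with ℓ hℓ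
  have hℓ1 : (1 : ℝ) ≤ ℓ := by exact_mod_cast (Nat.le_add_left 1 _).trans hℓ
  have hcℓ : 1 + c ≤ ℓ := (Nat.le_ceil _).trans (by exact_mod_cast (Nat.le_succ _).trans hℓ)
  rw [Real.norm_of_nonneg (Real.log_nonneg (le_add_of_nonneg_right (by positivity))),
    Real.norm_of_nonneg (Real.log_nonneg hℓ1)]
  calc Real.log (1 + c * ℓ) ≤ Real.log (ℓ ^ 2) :=
        Real.log_le_log (by positivity) (by nlinarith)
    _ = 2 * Real.log ℓ := by rw [Real.log_pow, Nat.cast_ofNat]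

end Selection

end QAVC

theorem proposition4 {J : Type*} [Fintype J] [DecidableEq J] (δ : ℝ) (hδ : 0 < δ) :
    -- `bits ℓ` bounds the number of shared random bits; it depends on `J`, `δ`, `ℓ` only
    ∃ bits : ℕ → ℝ, bits =O[Filter.atTop] (fun ℓ : ℕ => Real.log ℓ) ∧
      ∀ {A : Type*} {B : Type*} [Fintype A] [DecidableEq A] [Fintype B] [DecidableEq B]
        (N : QAVC.Channel (A × J) B) (ℓ : ℕ) {Λ : Type*} [MeasurableSpace Λ] (ε : ℝ),
        (∀ (M : ℕ) (C : QAVC.RandomClassicalCode N ℓ M Λ), C.HasError ε →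
          ∃ (n : ℕ) (_ : NeZero n) (lam : Fin n → Λ),
            (n : ℝ) ≤ 1 + 1 / (2 * δ ^ 2) * Real.log (Fintype.card J) * ℓ ∧
            Real.logb 2 n ≤ bits ℓ ∧
            (C.select lam).HasError (ε + δ)) ∧
        (∀ (L : ℕ) (C : QAVC.RandomQuantumCode N ℓ L Λ), C.HasError ε →
          ∃ (n : ℕ) (_ : NeZero n) (lam : Fin n → Λ),
            (n : ℝ) ≤ 1 + 1 / (2 * δ ^ 2) * Real.log (Fintype.card J) * ℓ ∧
            Real.logb 2 n ≤ bits ℓ ∧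
            (C.select lam).HasError (ε + δ)) := by
  set c : ℝ := 1 / (2 * δ ^ 2) * Real.log (Fintype.card J)
  refine ⟨fun ℓ => Real.logb 2 (1 + c * ℓ), QAVC.isBigO_logb_one_add_mul (by positivity) 2, ?_⟩
  intro A B _ _ _ _ N ℓ Λ _ ε
  have hcard : 1 / (2 * δ ^ 2) * Real.log (Fintype.card (Fin ℓ → J)) = c * ℓ := by
    rw [Fintype.card_fun, Fintype.card_fin, Nat.cast_pow, Real.log_pow]
    ring
  have hbits {n : ℕ} (hn0 : NeZero n) (hn : (n : ℝ) ≤ 1 + c * ℓ) :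
      Real.logb 2 n ≤ Real.logb 2 (1 + c * ℓ) :=
    Real.logb_le_logb_of_le one_lt_two (Nat.cast_pos.2 hn0.pos) hn
  refine ⟨fun M C hC => ?_, fun L C hC => ?_⟩
  · obtain ⟨n, hn0, lam, hn, hlam⟩ := hC.exists_le_select_add (QAVC.exists_isEffect_errorProb N) hδ
    rw [hcard] at hn
    exact ⟨n, hn0, lam, hn, hbits hn0 hn, hlam⟩
  · obtain ⟨n, hn0, lam, hn, hlam⟩ := hC.exists_le_select_add (QAVC.exists_isEffect_infidelity N) hδ
    rw [hcard] at hn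
    exact ⟨n, hn0, lam, hn, hbits hn0 hn, hlam⟩
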